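/- Let $\mathcal X$ be a measurable space, $\mathcal Y\subseteq\mathbb R$, let $p$ be a probability distribution on $\mathcal X\times\mathcal Y$, and let $\mathcal H$ be a set of measurable functions $h:\mathcal X\to\mathcal Y$. Let $\|\cdot\|$ be a norm on $\mathbb R^2$ with $\|(1,0)\|\le 1$ (for instance any $\ell_q$-norm), and assume that for some constant $D>0$ $$\|(h(x'),y')-(h(x),y)\|\le D\qquad\text{for all } h\in\mathcal H,\ (x,y),(x',y')\in\mathcal X\times\mathcal Y.$$ Let $\ell_1,\dots,\ell_N:\mathcal Y\times\mathcal Y\to[0,\infty)$ be loss functions, bounded above by a common constant $M$, such that $\ell_i$ is $M_i$-Lipschitz with respect to this norm for some $M_i\ge 0$, that is, $|\ell_i(y,a)-\ell_i(y',a')|\le M_i\,\|(a,y)-(a',y')\|$ for all $y,a,y',a'\in\mathcal Y$. For a dataset $S=((x_1,y_1),\dots,(x_n,y_n))$ of size $n\ge 1$, drawn i.i.d. from $p$, set $$\mathcal L_i(h)=\mathbb E_{(x,y)\sim p}[\ell_i(y,h(x))],\qquad \hat{\mathcal L}_i(h)=\frac1n\sum_{j=1}^n\ell_i(y_j,h(x_j)).$$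 Let $W$ be a non-empty subset of the probability simplex $\Delta_N\subset\mathbb R^N$ such that $\sum_{i=1}^N w_iM_i\le\beta$ for all $w\in W$, and set $$\mathcal L_W(h)=\sup_{w\in W}\sum_{i=1}^N w_i\mathcal L_i(h),\qquad \hat{\mathcal L}_W(h)=\sup_{w\in W}\sum_{i=1}^N w_i\hat{\mathcal L}_i(h).$$ Let $\hat{\mathfrak R}_S(\mathcal H)=\mathbb E_\sigma\big[\sup_{h\in\mathcal H}\frac1n\sum_{j=1}^n\sigma_jh(x_j)\big]$, with $\sigma$ uniformly distributed on $\{-1,1\}^n$, be the empirical Rademacher complexity of $\mathcal H$ with respect to $S$. Assume, as is usual for uncountable $\mathcal H$, that the relevant suprema are measurable: for each $i$, every $m\ge0$, $a\in\mathbb R^m$ and $b\in\mathbb R$, the function $\sup_{h\in\mathcal H}\big(b\,\mathcal L_i(h)+\sum_{j=1}^m a_j\,\ell_i(y_j,h(x_j))\big)$ of $((x_1,y_1),\dots,(x_m,y_m))$ is measurable up to $p^m$-null sets. Then, for any $\delta\in(0,1)$, with probability at least $1-\delta$ over $S$, the following inequality holds for all $h\in\mathcal H$: $$\mathcal L_W(h)\le\hat{\mathcal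 L}_W(h)+2\beta\,\hat{\mathfrak R}_S(\mathcal H)+3\beta D\sqrt{\frac{\log\frac{2N}{\delta}}{2n}}.$$ -/

import Mathlib

open MeasureTheory

noncomputable section

/-- The expected loss `E_{(x,y) ∼ P} [ℓ (y, h x)]` of a hypothesis `h : 𝓧 → 𝓨`, where `𝓨 ⊆ ℝ`. -/
def risk {X : Type*} [MeasurableSpace X] {Y : Set ℝ} (P : Measure (X × Y))
    (ℓ : Y → Y → ℝ) (h : X → Y) : ℝ :=
  ∫ z, ℓ z.2 (h z.1) ∂P

/-- The empirical loss `(1/n) ∑ⱼ ℓ (yⱼ, h xⱼ)` on the sample `S = ((x₁,y₁),…,(xₙ,yₙ))`. -/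
def empRisk {X : Type*} {Y : Set ℝ} {n : ℕ} (S : Fin n → X × Y)
    (ℓ : Y → Y → ℝ) (h : X → Y) : ℝ :=
  (1 / (n : ℝ)) * ∑ j, ℓ (S j).2 (h (S j).1)

/-- The scalarization `sup_{w ∈ W} ∑ᵢ wᵢ vᵢ` of a vector `v` of objective values. -/
def scalarize {N : ℕ} (W : Set (Fin N → ℝ)) (v : Fin N → ℝ) : ℝ :=
  ⨆ w : W, ∑ i, (w : Fin N → ℝ) i * v i

/-- The empirical Rademacher complexity
`E_σ [ sup_{h ∈ H} (1/n) ∑ⱼ σⱼ h(xⱼ) ]`, with `σ` uniformly distributed on `{-1, 1}ⁿ`. -/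
def empRademacher {X : Type*} {Y : Set ℝ} {n : ℕ} (S : Fin n → X × Y)
    (H : Set (X → Y)) : ℝ :=
  (1 / 2 ^ n : ℝ) * ∑ σ : Fin n → ℤˣ,
    ⨆ h : H, (1 / (n : ℝ)) * ∑ j, (((σ j : ℤ) : ℝ)) * (((h : X → Y) (S j).1 : Y) : ℝ)

/-- The measurability convention for suprema over a (possibly uncountable) hypothesis set:
for every sample size `m`, suprema over `h ∈ H` of linear combinations of the expected loss
of `h` and of its losses at the `m` sample points are measurable functions of the sample,
up to null sets. -/
def MeasurableSuprema {X : Type*} [MeasurableSpace X] {Y : Set ℝ} (P : Measure (X × Y))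
    (ℓ : Y → Y → ℝ) (H : Set (X → Y)) : Prop :=
  ∀ (m : ℕ) (a : Fin m → ℝ) (b : ℝ),
    AEMeasurable
      (fun S : Fin m → X × Y =>
        ⨆ h : H, (b * risk P ℓ h + ∑ j, a j * ℓ (S j).2 ((h : X → Y) (S j).1)))
      (Measure.pi fun _ => P)

end

/-!
Fix one loss and let `g h z` be the loss of the hypothesis `h` at the example `z`. By the Lipschitz
condition and the diameter condition, `g h` oscillates by at most `c = M i * D`. Both the maximal
deviation `Φ S = sup_h (E[g h] - (1/n) ∑ⱼ g h (Sⱼ))` and the Rademacher average `R S` of the class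
`g` change by at most `c / n` when one sample point changes, so by McDiarmid's inequality
(`hasSubgaussianMGF_of_bounded_differences`) each is within `c √(u / 2n)` of its mean, on the side
that matters, up to probability `exp (-u)`. With `E[Φ] ≤ 2 E[R]` (`integral_deviation_le`) this
gives `Φ ≤ 2 R + 3 c √(u / 2n)` up to probability `2 exp (-u)`. Talagrand's contraction principle
(`rademacherAvg_contraction`) bounds `R S` by `M i` times the Rademacher complexity of the
hypothesis set, sample by sample. With `u = log (2 N / δ)` a union bound over the `N` losses costs
`δ`, and on the good event the bounds, being linear in `M i`, combine under the weights to the claim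
for the scalarizations (`scalarize_le_scalarize_add`).

Measurability dictates the form of two arguments. McDiarmid's inequality is proved by induction on
the number of coordinates for functions that are only a.e. measurable, combining Hoeffding's lemma
with Fubini's theorem. Symmetrization treats one sample point at a time: if `A h` depends on the
other points only, then subadditivity of the supremum and Jensen's inequality give
`E sup_h (A h + t E[g h] - t g h z) ≤ ½ E sup_h (A h + 2 t g h z) + ½ E sup_h (A h - 2 t g h z)`.
The Rademacher complexity of the hypothesis set itself need not be measurable in the sample, since
it enters only after the contraction principle, pointwise.
-/

/-! ### Bounded differences -/

theorem measurePreserving_insertNth {Z : Type*} [MeasurableSpace Z] (P : Measure Z)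
    [IsProbabilityMeasure P] {n : ℕ} (j : Fin (n + 1)) :
    MeasurePreserving (fun p : Z × (Fin n → Z) => (j.insertNth p.1 p.2 : Fin (n + 1) → Z))
      (P.prod (Measure.pi fun _ => P)) (Measure.pi fun _ => P) :=
  (measurePreserving_piFinSuccAbove (fun _ : Fin (n + 1) => P) j).symm

theorem integrable_of_abs_le {Ω : Type*} [MeasurableSpace Ω] {μ : Measure Ω} [IsFiniteMeasure μ]
    {f : Ω → ℝ} {K : ℝ} (hf : AEMeasurable f μ) (hK : ∀ x, |f x| ≤ K) : Integrable f μ :=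
  Integrable.of_bound hf.aestronglyMeasurable K (Filter.Eventually.of_forall hK)

/-- **McDiarmid's inequality**, in sub-Gaussian form. Only a.e. measurability is assumed, so the
sections of `f` are measurable for almost every, not for every, value of a coordinate. -/
theorem hasSubgaussianMGF_of_bounded_differences {Z : Type*} [MeasurableSpace Z] (P : Measure Z)
    [IsProbabilityMeasure P] (c : NNReal) (K : ℝ) (n : ℕ) (f : (Fin n → Z) → ℝ)
    (hf : AEMeasurable f (Measure.pi fun _ => P)) (hK : ∀ S, |f S| ≤ K)
    (hc : ∀ S j z, |f (Function.update S j z) - f S| ≤ c) :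
    ProbabilityTheory.HasSubgaussianMGF (fun S => f S - ∫ S', f S' ∂(Measure.pi fun _ => P))
      (n * (c / 2) ^ 2) (Measure.pi fun _ => P) := by
  induction n with
  | zero =>
    have hconst : f = fun _ => f default := funext fun S => by rw [Subsingleton.elim S default]
    rw [hconst]
    simp
  | succ n ih =>
    set μ : Measure (Fin n → Z) := Measure.pi fun _ => P with hμ
    set m := ∫ S', f S' ∂(Measure.pi fun _ => P) with hm
    set T : Z × (Fin n → Z) → (Fin (n + 1) → Z) := fun p => (0 : Fin (n + 1)).insertNth p.1 p.2
      with hT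
    have hTm : MeasurePreserving T (P.prod μ) (Measure.pi fun _ => P) :=
      measurePreserving_insertNth P 0
    set F : Z × (Fin n → Z) → ℝ := fun p => f (T p) with hF
    have hFm : AEMeasurable F (P.prod μ) :=
      hf.comp_quasiMeasurePreserving hTm.quasiMeasurePreserving
    have hFi : Integrable F (P.prod μ) := integrable_of_abs_le hFm fun p => hK _
    have hsec : ∀ᵐ z ∂P, AEMeasurable (fun s => F (z, s)) μ := by
      filter_upwards [hFm.aestronglyMeasurable.prodMk_left] with z hz using hz.aemeasurable
    set φ : Z → ℝ := fun z => ∫ s, F (z, s) ∂μ with hφ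
    have hφi : Integrable φ P := hFi.integral_prod_left
    have hmφ : m = ∫ z, φ z ∂P := by
      rw [hm, ← hTm.map_eq, integral_map hTm.measurable.aemeasurable
        (by rw [hTm.map_eq]; exact hf.aestronglyMeasurable)]
      exact integral_prod F hFi
    have hosc : ∀ z z' s, |F (z', s) - F (z, s)| ≤ c := by
      intro z z' s
      have := hc (T (z, s)) 0 z'
      simpa [hF, hT, Fin.insertNth_zero, Fin.update_cons_zero] using this
    have hφrange : ∃ a : ℝ, ∀ᵐ z ∂P, φ z ∈ Set.Icc a (a + c) := by
      -- the oscillation bound is available only between points whose sections are measurable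
      set G := {z | AEMeasurable (fun s => F (z, s)) μ} with hG
      have hGne : G.Nonempty := hsec.exists
      have hdiff : ∀ z ∈ G, ∀ z' ∈ G, φ z' - φ z ≤ c := by
        intro z hz z' hz'
        have h1 : Integrable (fun s => F (z, s)) μ := integrable_of_abs_le hz fun s => hK _
        have h2 : Integrable (fun s => F (z', s)) μ := integrable_of_abs_le hz' fun s => hK _
        rw [hφ, ← integral_sub h2 h1]
        calc ∫ s, (F (z', s) - F (z, s)) ∂μ ≤ ∫ _, (c : ℝ) ∂μ :=
              integral_mono (h2.sub h1) (integrable_const _) fun s => (abs_le.1 (hosc z z' s)).2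
          _ = c := by simp
      obtain ⟨z₀, hz₀⟩ := hGne
      have hbdd : BddBelow (φ '' G) := by
        refine ⟨φ z₀ - c, ?_⟩
        rintro _ ⟨z, hz, rfl⟩
        linarith [hdiff z hz z₀ hz₀]
      refine ⟨sInf (φ '' G), ?_⟩
      filter_upwards [hsec] with z hz
      refine ⟨csInf_le hbdd ⟨z, hz, rfl⟩, ?_⟩
      have : φ z - c ≤ sInf (φ '' G) := by
        refine le_csInf ⟨_, z₀, hz₀, rfl⟩ ?_
        rintro _ ⟨z', hz', rfl⟩
        linarith [hdiff z' hz' z hz]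
      linarith
    obtain ⟨a, ha⟩ := hφrange
    have hsubφ := ProbabilityTheory.hasSubgaussianMGF_of_mem_Icc hφi.aemeasurable ha
    rw [← hmφ] at hsubφ
    have hexp : ∀ t : ℝ, ∀ S, |Real.exp (t * (f S - m))| ≤ Real.exp (|t| * (K + |m|)) := by
      intro t S
      rw [abs_of_pos (Real.exp_pos _), Real.exp_le_exp]
      calc t * (f S - m) ≤ |t * (f S - m)| := le_abs_self _
        _ = |t| * |f S - m| := abs_mul _ _
        _ ≤ |t| * (K + |m|) := by
          gcongr
          exact (abs_sub _ _).trans (by gcongr; exact hK S)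
    have hexpm : ∀ t : ℝ, AEMeasurable (fun S => Real.exp (t * (f S - m)))
        (Measure.pi fun _ => P) := fun t =>
      Real.measurable_exp.comp_aemeasurable ((hf.sub_const m).const_mul t)
    refine ⟨fun t => integrable_of_abs_le (hexpm t) (hexp t), fun t => ?_⟩
    have hEi : Integrable (fun p => Real.exp (t * (F p - m))) (P.prod μ) :=
      integrable_of_abs_le ((hexpm t).comp_quasiMeasurePreserving hTm.quasiMeasurePreserving)
        fun p => hexp t _
    have hsplit : ProbabilityTheory.mgf (fun S => f S - m) (Measure.pi fun _ => P) t
        = ∫ z, ∫ s, Real.exp (t * (F (z, s) - m)) ∂μ ∂P := by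
      rw [ProbabilityTheory.mgf, ← hTm.map_eq, integral_map hTm.measurable.aemeasurable
        (by rw [hTm.map_eq]; exact (hexpm t).aestronglyMeasurable)]
      exact integral_prod _ hEi
    rw [hsplit]
    set v : ℝ := (c / 2) ^ 2 with hv
    have hinner : ∀ᵐ z ∂P, ∫ s, Real.exp (t * (F (z, s) - m)) ∂μ
        ≤ Real.exp (n * v * t ^ 2 / 2) * Real.exp (t * (φ z - m)) := by
      filter_upwards [hsec] with z hz
      have h := (ih (fun s => F (z, s)) hz (fun s => hK _) (fun s j z' => by
        have := hc (T (z, s)) j.succ z'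
        simpa [hF, hT, Fin.insertNth_zero, Fin.cons_update] using this)).mgf_le t
      rw [ProbabilityTheory.mgf] at h
      have : ∀ s, Real.exp (t * (F (z, s) - m))
          = Real.exp (t * (F (z, s) - φ z)) * Real.exp (t * (φ z - m)) := fun s => by
        rw [← Real.exp_add]; ring_nf
      simp_rw [this]
      rw [integral_mul_const]
      gcongr
      simpa [hv] using h
    calc ∫ z, ∫ s, Real.exp (t * (F (z, s) - m)) ∂μ ∂P
        ≤ ∫ z, Real.exp (n * v * t ^ 2 / 2) * Real.exp (t * (φ z - m)) ∂P :=
          integral_mono_ae hEi.integral_prod_left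
            ((hsubφ.integrable_exp_mul t).const_mul _) hinner
      _ = Real.exp (n * v * t ^ 2 / 2) * ∫ z, Real.exp (t * (φ z - m)) ∂P :=
          integral_const_mul _ _
      _ ≤ Real.exp (n * v * t ^ 2 / 2) * Real.exp (v * t ^ 2 / 2) := by
          gcongr
          have := hsubφ.mgf_le t
          simpa [ProbabilityTheory.mgf, hv] using this
      _ = _ := by
          rw [← Real.exp_add]
          congr 1
          push_cast
          rw [hv]
          ring

/-- The upper tail of McDiarmid's inequality, solved for the deviation: a failure probability of
`exp (-u)` for coordinate differences `c / n` costs `c * √(u / (2 n))`. -/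
theorem measureReal_bounded_differences_le {Z : Type*} [MeasurableSpace Z] (P : Measure Z)
    [IsProbabilityMeasure P] {c K u : ℝ} (hc0 : 0 < c) (hu : 0 ≤ u) {n : ℕ} (hn : 0 < n)
    (f : (Fin n → Z) → ℝ)
    (hf : AEMeasurable f (Measure.pi fun _ => P)) (hK : ∀ S, |f S| ≤ K)
    (hc : ∀ S j z, |f (Function.update S j z) - f S| ≤ c / n) :
    (Measure.pi fun _ => P).real
      {S | c * Real.sqrt (u / (2 * n)) ≤ f S - ∫ S', f S' ∂(Measure.pi fun _ => P)}
      ≤ Real.exp (-u) := by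
  have hn' : (0 : ℝ) < n := by exact_mod_cast hn
  have hcn : ((c / n).toNNReal : ℝ) = c / n := Real.coe_toNNReal _ (by positivity)
  have h := (hasSubgaussianMGF_of_bounded_differences P (c / n).toNNReal K n f hf hK
    (by simpa only [hcn] using hc)).measure_ge_le (ε := c * Real.sqrt (u / (2 * n))) (by positivity)
  refine h.trans (le_of_eq ?_)
  congr 1
  push_cast
  rw [mul_pow, Real.sq_sqrt (by positivity), hcn]
  field_simp

/-! ### Suprema of bounded families -/

theorem abs_ciSup_le {ι : Type*} [Nonempty ι] {f : ι → ℝ} {K : ℝ} (h : ∀ i, |f i| ≤ K) :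
    |⨆ i, f i| ≤ K := by
  have hb : BddAbove (Set.range f) := ⟨K, by rintro _ ⟨i, rfl⟩; exact (abs_le.1 (h i)).2⟩
  refine abs_le.2 ⟨?_, ciSup_le fun i => (abs_le.1 (h i)).2⟩
  obtain ⟨i⟩ := ‹Nonempty ι›
  exact (abs_le.1 (h i)).1.trans (le_ciSup hb i)

theorem bddAbove_range_of_abs_le {ι : Type*} {f : ι → ℝ} {K : ℝ} (h : ∀ i, |f i| ≤ K) :
    BddAbove (Set.range f) := ⟨K, by rintro _ ⟨i, rfl⟩; exact (abs_le.1 (h i)).2⟩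

theorem ciSup_sub_ciSup_le {ι : Type*} [Nonempty ι] {f g : ι → ℝ} {K : ℝ}
    (hg : BddAbove (Set.range g)) (h : ∀ i, |f i - g i| ≤ K) :
    (⨆ i, f i) - (⨆ i, g i) ≤ K := by
  rw [sub_le_iff_le_add]
  refine ciSup_le fun i => ?_
  linarith [(abs_le.1 (h i)).2, le_ciSup hg i]

theorem abs_ciSup_sub_ciSup_le {ι : Type*} [Nonempty ι] {f g : ι → ℝ} {K : ℝ}
    (hf : BddAbove (Set.range f)) (hg : BddAbove (Set.range g)) (h : ∀ i, |f i - g i| ≤ K) :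
    |(⨆ i, f i) - (⨆ i, g i)| ≤ K :=
  abs_sub_le_iff.2 ⟨ciSup_sub_ciSup_le hg h,
    ciSup_sub_ciSup_le hf fun i => by rw [abs_sub_comm]; exact h i⟩

/-! ### Averages over sign vectors -/

/-- The involution of sign vectors that changes the sign of coordinate `j`. -/
noncomputable def signFlip {n : ℕ} (j : Fin n) : Equiv.Perm (Fin n → ℤˣ) :=
  Equiv.mulRight (Pi.mulSingle j (-1))

@[simp]
theorem signFlip_apply_self {n : ℕ} (j : Fin n) (σ : Fin n → ℤˣ) : signFlip j σ j = -σ j := by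
  simp [signFlip]

theorem signFlip_apply_of_ne {n : ℕ} {j k : Fin n} (h : k ≠ j) (σ : Fin n → ℤˣ) :
    signFlip j σ k = σ k := by
  simp [signFlip, Pi.mulSingle_eq_of_ne h]

/-- To compare two sums over sign vectors, it suffices to compare them on each pair of vectors
that differ only in the sign of coordinate `j`. -/
theorem sum_signs_le_of_pairs {n : ℕ} (j : Fin n) {F G : (Fin n → ℤˣ) → ℝ}
    (h : ∀ σ, F σ + F (signFlip j σ) ≤ G σ + G (signFlip j σ)) : ∑ σ, F σ ≤ ∑ σ, G σ := by
  have hsum := Finset.sum_le_sum fun σ (_ : σ ∈ Finset.univ) => h σ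
  rw [Finset.sum_add_distrib, Finset.sum_add_distrib, Equiv.sum_comp (signFlip j) F,
    Equiv.sum_comp (signFlip j) G] at hsum
  linarith

theorem abs_sign {n : ℕ} (σ : Fin n → ℤˣ) (j : Fin n) : |((σ j : ℤ) : ℝ)| = 1 := by
  rcases Int.units_eq_one_or (σ j) with h | h <;> simp [h]

/-- The Rademacher average `E_σ [sup_i (1/n) ∑ⱼ σⱼ u i j]` of a family of vectors in `ℝⁿ`. -/
noncomputable def rademacherAvg {ι : Type*} {n : ℕ} (u : ι → Fin n → ℝ) : ℝ :=
  (1 / 2 ^ n : ℝ) * ∑ σ : Fin n → ℤˣ, ⨆ i, (1 / (n : ℝ)) * ∑ j, ((σ j : ℤ) : ℝ) * u i j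

theorem abs_sum_signs_le {n : ℕ} (σ : Fin n → ℤˣ) {u : Fin n → ℝ} {K : ℝ}
    (hu : ∀ j, |u j| ≤ K) : |(1 / (n : ℝ)) * ∑ j, ((σ j : ℤ) : ℝ) * u j|
      ≤ (1 / (n : ℝ)) * (n * K) := by
  rw [abs_mul, abs_of_nonneg (by positivity)]
  gcongr
  refine (Finset.abs_sum_le_sum_abs _ _).trans ?_
  refine (Finset.sum_le_sum fun j _ => ?_).trans_eq (by simp : ∑ _ : Fin n, K = n * K)
  rw [abs_mul, abs_sign, one_mul]
  exact hu j

theorem bddAbove_sum_signs {ι : Type*} {n : ℕ} (σ : Fin n → ℤˣ) {u : ι → Fin n → ℝ} {K : ℝ}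
    (hu : ∀ i j, |u i j| ≤ K) :
    BddAbove (Set.range fun i => (1 / (n : ℝ)) * ∑ j, ((σ j : ℤ) : ℝ) * u i j) :=
  bddAbove_range_of_abs_le fun i => abs_sum_signs_le σ (hu i)

theorem rademacherAvg_const_mul {ι : Type*} {n : ℕ} {M : ℝ} (hM : 0 ≤ M) (u : ι → Fin n → ℝ) :
    rademacherAvg (fun i j => M * u i j) = M * rademacherAvg u := by
  have hinner : ∀ (σ : Fin n → ℤˣ) i, (1 / (n : ℝ)) * ∑ j, ((σ j : ℤ) : ℝ) * (M * u i j)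
      = M * ((1 / (n : ℝ)) * ∑ j, ((σ j : ℤ) : ℝ) * u i j) := fun σ i => by
    simp_rw [mul_left_comm _ M, ← Finset.mul_sum]
    ring
  simp only [rademacherAvg, hinner, ← Real.mul_iSup_of_nonneg hM, ← Finset.mul_sum]
  ring

/-- Each supremum dominates the value at a fixed `i`, and those values average to zero. -/
theorem rademacherAvg_nonneg {ι : Type*} [Nonempty ι] {n : ℕ} {u : ι → Fin n → ℝ} {K : ℝ}
    (hu : ∀ i j, |u i j| ≤ K) : 0 ≤ rademacherAvg u := by
  obtain ⟨i⟩ := ‹Nonempty ι›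
  refine mul_nonneg (by positivity) ?_
  have hzero : ∑ σ : Fin n → ℤˣ, (1 / (n : ℝ)) * ∑ j, ((σ j : ℤ) : ℝ) * u i j = 0 := by
    have h := Equiv.sum_comp (Equiv.neg (Fin n → ℤˣ))
      fun σ : Fin n → ℤˣ => (1 / (n : ℝ)) * ∑ j, ((σ j : ℤ) : ℝ) * u i j
    simp only [Equiv.neg_apply, Pi.neg_apply, Units.val_neg, Int.cast_neg, neg_mul,
      Finset.sum_neg_distrib, mul_neg] at h
    linarith
  rw [← hzero]
  exact Finset.sum_le_sum fun σ _ => le_ciSup (bddAbove_sum_signs σ hu) i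

/-- The pairing at the heart of the contraction principle: the left side is a supremum of
`A i + A i' + (φ i - φ i')`, and the right side is symmetric in `i, i'`, hence sees
`|ψ i - ψ i'|`. -/
theorem ciSup_add_ciSup_sub_le {ι : Type*} [Nonempty ι] {A φ ψ : ι → ℝ}
    (hadd : BddAbove (Set.range fun i => A i + ψ i))
    (hsub : BddAbove (Set.range fun i => A i - ψ i))
    (h : ∀ i i', |φ i - φ i'| ≤ |ψ i - ψ i'|) :
    (⨆ i, (A i + φ i)) + (⨆ i, (A i - φ i)) ≤ (⨆ i, (A i + ψ i)) + (⨆ i, (A i - ψ i)) := by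
  set C := (⨆ i, (A i + ψ i)) + (⨆ i, (A i - ψ i)) with hC
  have key : ∀ i i', (A i + φ i) + (A i' - φ i') ≤ C := by
    intro i i'
    have h1 := (le_abs_self _).trans (h i i')
    rcases abs_cases (ψ i - ψ i') with ⟨habs, _⟩ | ⟨habs, _⟩
    · linarith [le_ciSup hadd i, le_ciSup hsub i']
    · linarith [le_ciSup hadd i', le_ciSup hsub i]
  have h1 : ∀ i', ⨆ i, (A i + φ i) ≤ C - (A i' - φ i') := fun i' =>
    ciSup_le fun i => by linarith [key i i']
  have h2 : ⨆ i, (A i - φ i) ≤ C - ⨆ i, (A i + φ i) :=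
    ciSup_le fun i' => by linarith [h1 i']
  linarith

/-- **Talagrand's contraction principle**, proved by replacing `v` by `M * u` one coordinate at a
time. -/
theorem rademacherAvg_contraction {ι : Type*} [Nonempty ι] {n : ℕ} {u v : ι → Fin n → ℝ}
    {M K : ℝ} (hM : 0 ≤ M) (hu : ∀ i j, |u i j| ≤ K) (hv : ∀ i j, |v i j| ≤ K)
    (huv : ∀ i i' j, |v i j - v i' j| ≤ M * |u i j - u i' j|) :
    rademacherAvg v ≤ M * rademacherAvg u := by
  rw [← rademacherAvg_const_mul hM]
  let w : Finset (Fin n) → ι → Fin n → ℝ := fun s i j => if j ∈ s then M * u i j else v i j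
  have hw : ∀ s i j, |w s i j| ≤ (M + 1) * K := by
    intro s i j
    have hK : 0 ≤ K := (abs_nonneg _).trans (hu i j)
    have hMK : 0 ≤ M * K := mul_nonneg hM hK
    simp only [w]
    split_ifs
    · rw [abs_mul, abs_of_nonneg hM]
      nlinarith [mul_le_mul_of_nonneg_left (hu i j) hM]
    · nlinarith [hv i j]
  suffices h : ∀ s, rademacherAvg (w ∅) ≤ rademacherAvg (w s) by
    simpa [w] using h Finset.univ
  intro s
  induction s using Finset.induction_on with
  | empty => exact le_rfl
  | insert j s hj ih =>
    refine ih.trans ?_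
    unfold rademacherAvg
    refine mul_le_mul_of_nonneg_left (sum_signs_le_of_pairs j fun σ => ?_) (by positivity)
    let A : ι → ℝ := fun i =>
      (1 / (n : ℝ)) * ∑ k ∈ Finset.univ.erase j, ((σ k : ℤ) : ℝ) * w s i k
    have split : ∀ (τ : Fin n → ℤˣ) (t : Finset (Fin n)), (∀ k, k ≠ j → τ k = σ k) →
        (∀ i k, k ≠ j → w t i k = w s i k) → ∀ i,
        (1 / (n : ℝ)) * ∑ k, ((τ k : ℤ) : ℝ) * w t i k
          = A i + (1 / (n : ℝ)) * (((τ j : ℤ) : ℝ) * w t i j) := by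
      intro τ t hτ ht i
      rw [← Finset.add_sum_erase _ _ (Finset.mem_univ j), mul_add, add_comm]
      congr 2
      refine Finset.sum_congr rfl fun k hk => ?_
      rw [hτ k (Finset.ne_of_mem_erase hk), ht i k (Finset.ne_of_mem_erase hk)]
    have hins : ∀ i k, k ≠ j → w (insert j s) i k = w s i k := fun i k hk => by simp [w, hk]
    have hflip : ∀ k, k ≠ j → signFlip j σ k = σ k := fun k hk => signFlip_apply_of_ne hk σ
    have b1 := bddAbove_sum_signs σ (hw (insert j s))
    have b2 := bddAbove_sum_signs (signFlip j σ) (hw (insert j s))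
    simp only [split σ s (fun _ _ => rfl) (fun _ _ _ => rfl),
      split (signFlip j σ) s hflip (fun _ _ _ => rfl),
      split σ (insert j s) (fun _ _ => rfl) hins,
      split (signFlip j σ) (insert j s) hflip hins, signFlip_apply_self, Units.val_neg,
      Int.cast_neg, neg_mul, mul_neg, ← sub_eq_add_neg] at b1 b2 ⊢
    refine ciSup_add_ciSup_sub_le b1 b2 fun i i' => ?_
    simp only [w, hj, Finset.mem_insert_self, if_true, if_false]
    rw [← mul_sub, ← mul_sub, ← mul_sub, ← mul_sub, ← mul_sub, abs_mul, abs_mul, abs_mul, abs_mul,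
      abs_mul M, abs_of_nonneg hM]
    gcongr
    exact huv i i' j

/-! ### Symmetrization -/

/-- The supremum `sup_i (b E[g i] + ∑ⱼ aⱼ g i (Sⱼ))` of linear combinations of the expectation of
`g i` and its values on the sample `S`. -/
noncomputable def lossSup {ι Z : Type*} [MeasurableSpace Z] (P : Measure Z) (g : ι → Z → ℝ) {n : ℕ}
    (b : ℝ) (a : Fin n → ℝ) (S : Fin n → Z) : ℝ :=
  ⨆ i, (b * ∫ z, g i z ∂P + ∑ j, a j * g i (S j))

/-- The Rademacher average of the family `g` on a sample is an average of the suprema `lossSup`. -/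
theorem rademacherAvg_eq_sum_lossSup {ι Z : Type*} [MeasurableSpace Z] (P : Measure Z)
    (g : ι → Z → ℝ) {n : ℕ} (S : Fin n → Z) :
    rademacherAvg (fun i j => g i (S j))
      = (1 / 2 ^ n : ℝ) *
        ∑ σ : Fin n → ℤˣ, lossSup P g 0 (fun j => ((σ j : ℤ) : ℝ) * (1 / (n : ℝ))) S := by
  unfold rademacherAvg lossSup
  congr! 4 with σ _ i
  rw [zero_mul, zero_add, Finset.mul_sum]
  exact Finset.sum_congr rfl fun j _ => by ring

section

variable {ι Z : Type*} [MeasurableSpace Z] {P : Measure Z} [IsProbabilityMeasure P]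
  {g : ι → Z → ℝ} {B : ℝ}

theorem abs_integral_le_of_abs_le {f : Z → ℝ} (hf : ∀ z, |f z| ≤ B) : |∫ z, f z ∂P| ≤ B := by
  simpa using norm_integral_le_of_norm_le_const (μ := P) (f := f) (C := B)
    (Filter.Eventually.of_forall hf)

theorem abs_combination_le (hg : ∀ i z, |g i z| ≤ B) {n : ℕ} (b : ℝ) (a : Fin n → ℝ)
    (S : Fin n → Z) (i : ι) :
    |b * ∫ z, g i z ∂P + ∑ j, a j * g i (S j)| ≤ |b| * B + ∑ j, |a j| * B := by
  refine (abs_add_le _ _).trans (add_le_add ?_ ((Finset.abs_sum_le_sum_abs _ _).trans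
    (Finset.sum_le_sum fun j _ => ?_)))
  · rw [abs_mul]
    exact mul_le_mul_of_nonneg_left (abs_integral_le_of_abs_le (hg i)) (abs_nonneg _)
  · rw [abs_mul]
    exact mul_le_mul_of_nonneg_left (hg i _) (abs_nonneg _)

theorem bddAbove_combination (hg : ∀ i z, |g i z| ≤ B) {n : ℕ} (b : ℝ) (a : Fin n → ℝ)
    (S : Fin n → Z) :
    BddAbove (Set.range fun i => b * ∫ z, g i z ∂P + ∑ j, a j * g i (S j)) :=
  bddAbove_range_of_abs_le (abs_combination_le hg b a S)

variable [Nonempty ι]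

theorem abs_lossSup_le (hg : ∀ i z, |g i z| ≤ B) {n : ℕ} (b : ℝ) (a : Fin n → ℝ)
    (S : Fin n → Z) : |lossSup P g b a S| ≤ |b| * B + ∑ j, |a j| * B :=
  abs_ciSup_le (abs_combination_le hg b a S)

theorem integrable_lossSup (hg : ∀ i z, |g i z| ≤ B) {n : ℕ}
    (hmeas : ∀ (b : ℝ) (a : Fin n → ℝ),
      AEMeasurable (fun S => lossSup P g b a S) (Measure.pi fun _ => P))
    (b : ℝ) (a : Fin n → ℝ) : Integrable (lossSup P g b a) (Measure.pi fun _ => P) :=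
  integrable_of_abs_le (hmeas b a) (abs_lossSup_le hg b a)

theorem abs_lossSup_update_sub_le (hg : ∀ i z, |g i z| ≤ B) {c : ℝ}
    (hosc : ∀ i z z', |g i z - g i z'| ≤ c) {n : ℕ} (b : ℝ) (a : Fin n → ℝ) (S : Fin n → Z)
    (j : Fin n) (z : Z) :
    |lossSup P g b a (Function.update S j z) - lossSup P g b a S| ≤ |a j| * c := by
  refine abs_ciSup_sub_ciSup_le (bddAbove_combination hg _ _ _) (bddAbove_combination hg _ _ _)
    fun i => ?_
  rw [add_sub_add_left_eq_sub, ← Finset.sum_sub_distrib, Finset.sum_eq_single j]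
  · rw [Function.update_self, ← mul_sub, abs_mul]
    exact mul_le_mul_of_nonneg_left (hosc i _ _) (abs_nonneg _)
  · intro k _ hk
    rw [Function.update_of_ne hk, sub_self]
  · simp

theorem lossSup_midpoint_le (hg : ∀ i z, |g i z| ≤ B) {n : ℕ} {b b₁ b₂ : ℝ}
    {a a₁ a₂ : Fin n → ℝ} (hb : b = (b₁ + b₂) / 2) (ha : ∀ j, a j = (a₁ j + a₂ j) / 2)
    (S : Fin n → Z) :
    lossSup P g b a S ≤ (lossSup P g b₁ a₁ S + lossSup P g b₂ a₂ S) / 2 := by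
  refine ciSup_le fun i => ?_
  have h1 := le_ciSup (bddAbove_combination (P := P) hg b₁ a₁ S) i
  have h2 := le_ciSup (bddAbove_combination (P := P) hg b₂ a₂ S) i
  have hsum : ∑ j, a j * g i (S j)
      = (∑ j, a₁ j * g i (S j) + ∑ j, a₂ j * g i (S j)) / 2 := by
    rw [← Finset.sum_add_distrib, Finset.sum_div]
    exact Finset.sum_congr rfl fun j _ => by rw [ha]; ring
  rw [hsum, hb]
  unfold lossSup
  linarith

/-- A supremum of expectations is at most the expectation of the supremum: if coordinate `j` is
not used by `a`, a multiple of the expectation may be replaced by the same multiple of the value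
at the `j`-th sample point. -/
theorem integral_lossSup_le_update (hgm : ∀ i, Measurable (g i)) (hg : ∀ i z, |g i z| ≤ B)
    {n : ℕ} (hmeas : ∀ (b : ℝ) (a : Fin n → ℝ),
      AEMeasurable (fun S => lossSup P g b a S) (Measure.pi fun _ => P))
    (b c : ℝ) (a : Fin n → ℝ) (j : Fin n) (haj : a j = 0) :
    ∫ S, lossSup P g (b + c) a S ∂(Measure.pi fun _ => P)
      ≤ ∫ S, lossSup P g b (Function.update a j c) S ∂(Measure.pi fun _ => P) := by
  cases n with
  | zero => exact j.elim0
  | succ n =>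
    set T : Z × (Fin n → Z) → (Fin (n + 1) → Z) := fun p => j.insertNth p.1 p.2 with hT
    have hTm : MeasurePreserving T (P.prod (Measure.pi fun _ => P)) (Measure.pi fun _ => P) :=
      measurePreserving_insertNth P j
    have hint : ∀ b a, Integrable (fun p => lossSup P g b a (T p))
        (P.prod (Measure.pi fun _ => P)) := fun b a =>
      hTm.integrable_comp_of_integrable (integrable_lossSup hg hmeas b a)
    have hfub : ∀ b a, ∫ S, lossSup P g b a S ∂(Measure.pi fun _ => P)
        = ∫ s, ∫ z, lossSup P g b a (T (z, s)) ∂P ∂(Measure.pi fun _ => P) := fun b a => by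
      rw [← integral_prod_symm _ (hint b a), ← hTm.map_eq,
        integral_map hTm.measurable.aemeasurable
        (by rw [hTm.map_eq]; exact (hmeas b a).aestronglyMeasurable)]
    rw [hfub, hfub]
    refine integral_mono_ae (hint _ _).integral_prod_right (hint _ _).integral_prod_right ?_
    filter_upwards [(hint b (Function.update a j c)).prod_left_ae] with s hs
    -- the value below does not depend on the coordinate `z`
    have hleft : ∀ z, lossSup P g (b + c) a (T (z, s))
        = ⨆ i, ((b + c) * ∫ z, g i z ∂P + ∑ k, a (j.succAbove k) * g i (s k)) := fun z => by
      unfold lossSup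
      simp [hT, Fin.sum_univ_succAbove _ j, haj]
    simp only [hleft, integral_const, probReal_univ, one_smul]
    refine ciSup_le fun i => ?_
    have hgi : Integrable (g i) P := integrable_of_abs_le (hgm i).aemeasurable (hg i)
    have hval : (b + c) * ∫ z, g i z ∂P + ∑ k, a (j.succAbove k) * g i (s k)
        = ∫ z, (c * g i z + (b * ∫ z, g i z ∂P + ∑ k, a (j.succAbove k) * g i (s k))) ∂P := by
      rw [integral_add (hgi.const_mul c) (integrable_const _), integral_const_mul]
      simp
      ring
    rw [hval]
    refine integral_mono ((hgi.const_mul c).add (integrable_const _)) hs fun z => ?_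
    refine le_trans (le_of_eq ?_) (le_ciSup (bddAbove_combination hg _ _ _) i)
    simp [hT, Fin.sum_univ_succAbove _ j]
    ring

/-- Symmetrization of one sample point. The combination is the midpoint of one where the sample
point enters with coefficient `-2 t` and one where it does not enter but the expectation enters
with an additional `2 t`. -/
theorem integral_lossSup_symmetrize (hgm : ∀ i, Measurable (g i)) (hg : ∀ i z, |g i z| ≤ B)
    {n : ℕ} (hmeas : ∀ (b : ℝ) (a : Fin n → ℝ),
      AEMeasurable (fun S => lossSup P g b a S) (Measure.pi fun _ => P))
    (b t : ℝ) (a : Fin n → ℝ) (j : Fin n) (haj : a j = -t) :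
    ∫ S, lossSup P g b a S ∂(Measure.pi fun _ => P)
      ≤ (∫ S, lossSup P g (b - t) (Function.update a j (2 * t)) S ∂(Measure.pi fun _ => P)
        + ∫ S, lossSup P g (b - t) (Function.update a j (-(2 * t))) S ∂(Measure.pi fun _ => P))
        / 2 := by
  have hint := integrable_lossSup hg hmeas
  have hjensen := integral_lossSup_le_update hgm hg hmeas (b - t) (2 * t)
    (Function.update a j 0) j (by simp)
  rw [Function.update_idem] at hjensen
  have hmid : ∫ S, lossSup P g b a S ∂(Measure.pi fun _ => P)
      ≤ ∫ S, (lossSup P g (b - t + 2 * t) (Function.update a j 0) S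
        + lossSup P g (b - t) (Function.update a j (-(2 * t))) S) / 2
        ∂(Measure.pi fun _ => P) := by
    refine integral_mono (hint _ _) (((hint _ _).add (hint _ _)).div_const 2) fun S => ?_
    refine lossSup_midpoint_le hg (by ring) (fun k => ?_) S
    by_cases hk : k = j
    · subst hk
      simp only [haj, Function.update_self]
      ring
    · simp [hk]
  rw [integral_div, integral_add (hint _ _) (hint _ _)] at hmid
  linarith

theorem integrable_rademacherAvg (hg : ∀ i z, |g i z| ≤ B) {n : ℕ}
    (hmeas : ∀ (b : ℝ) (a : Fin n → ℝ),
      AEMeasurable (fun S => lossSup P g b a S) (Measure.pi fun _ => P)) :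
    Integrable (fun S : Fin n → Z => rademacherAvg (fun i j => g i (S j)))
      (Measure.pi fun _ => P) := by
  simp only [rademacherAvg_eq_sum_lossSup P g]
  exact (integrable_finsetSum _ fun σ _ => integrable_lossSup hg hmeas _ _).const_mul _

/-- **Symmetrization**: the expected maximal deviation is at most twice the expected Rademacher
average. The sample points are symmetrized one at a time, so only the supremum over one sample
has to be measurable, and no independent second sample is needed. -/
theorem integral_deviation_le (hgm : ∀ i, Measurable (g i)) (hg : ∀ i z, |g i z| ≤ B)
    {n : ℕ} (hn : 0 < n) (hmeas : ∀ (b : ℝ) (a : Fin n → ℝ),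
      AEMeasurable (fun S => lossSup P g b a S) (Measure.pi fun _ => P)) :
    ∫ S, lossSup P g 1 (fun _ : Fin n => -(1 / (n : ℝ))) S ∂(Measure.pi fun _ => P)
      ≤ 2 * ∫ S : Fin n → Z, rademacherAvg (fun i j => g i (S j)) ∂(Measure.pi fun _ => P) := by
  have hn' : (n : ℝ) ≠ 0 := by positivity
  set t : ℝ := 1 / n with ht
  let V : ℝ → (Fin n → ℝ) → ℝ := fun b a => ∫ S, lossSup P g b a S ∂(Measure.pi fun _ => P)
  -- the points in `s` already carry random signs
  let coef : Finset (Fin n) → (Fin n → ℤˣ) → Fin n → ℝ := fun s σ j =>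
    if j ∈ s then ((σ j : ℤ) : ℝ) * (2 * t) else -t
  have hcard : (Fintype.card (Fin n → ℤˣ) : ℝ) = 2 ^ n := by
    simp [Fintype.card_pi]
  have main : ∀ s : Finset (Fin n), V 1 (fun _ => -t)
      ≤ (1 / 2 ^ n : ℝ) * ∑ σ, V (1 - s.card * t) (coef s σ) := by
    intro s
    induction s using Finset.induction_on with
    | empty =>
      have hcard' : ((Finset.univ : Finset (Fin n → ℤˣ)).card : ℝ) = 2 ^ n := hcard
      simp only [coef, Finset.notMem_empty, if_false, Finset.card_empty, Nat.cast_zero, zero_mul,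
        sub_zero, Finset.sum_const, nsmul_eq_mul, hcard']
      rw [← mul_assoc, one_div, inv_mul_cancel₀ (by positivity), one_mul]
    | insert j s hj ih =>
      refine ih.trans (mul_le_mul_of_nonneg_left ?_ (by positivity))
      refine sum_signs_le_of_pairs j fun σ => ?_
      have hb : 1 - ((insert j s).card : ℝ) * t = 1 - s.card * t - t := by
        rw [Finset.card_insert_of_notMem hj]
        push_cast
        ring
      have hflip : coef s (signFlip j σ) = coef s σ := by
        funext k
        by_cases hk : k = j
        · subst hk
          simp [coef, hj]
        · simp [coef, signFlip_apply_of_ne hk]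
      have hupd : ∀ τ : Fin n → ℤˣ, (∀ k, k ≠ j → τ k = σ k) →
          coef (insert j s) τ = Function.update (coef s σ) j (((τ j : ℤ) : ℝ) * (2 * t)) := by
        intro τ hτ
        funext k
        by_cases hk : k = j
        · subst hk
          simp [coef]
        · simp [coef, hk, hτ k hk]
      have hstep := integral_lossSup_symmetrize hgm hg hmeas (1 - s.card * t) t (coef s σ) j
        (by simp [coef, hj])
      rw [hflip, hb, hupd σ fun _ _ => rfl,
        hupd (signFlip j σ) fun k hk => signFlip_apply_of_ne hk σ, signFlip_apply_self]
      rcases Int.units_eq_one_or (σ j) with h | h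
      · simp only [h, Units.val_neg, Units.val_one, Int.cast_neg, Int.cast_one, one_mul, neg_mul]
        change V _ _ ≤ (V _ _ + V _ _) / 2 at hstep
        linarith
      · simp only [h, Units.val_neg, Units.val_one, Int.cast_neg, Int.cast_one, one_mul, neg_mul,
          neg_neg]
        change V _ _ ≤ (V _ _ + V _ _) / 2 at hstep
        linarith
  refine (main Finset.univ).trans (le_of_eq ?_)
  have hzero : 1 - ((Finset.univ : Finset (Fin n)).card : ℝ) * t = 0 := by
    rw [Finset.card_univ, Fintype.card_fin, ht]
    field_simp
    ring
  have hscale : ∀ (σ : Fin n → ℤˣ) (S : Fin n → Z), lossSup P g 0 (coef Finset.univ σ) S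
      = 2 * lossSup P g 0 (fun j => ((σ j : ℤ) : ℝ) * t) S := by
    intro σ S
    unfold lossSup
    rw [Real.mul_iSup_of_nonneg zero_le_two]
    congr! 2 with i
    simp only [coef, Finset.mem_univ, if_true, zero_mul, zero_add]
    rw [Finset.mul_sum]
    exact Finset.sum_congr rfl fun j _ => by ring
  simp only [V, hzero, hscale, rademacherAvg_eq_sum_lossSup P g, ← ht]
  simp only [integral_const_mul]
  rw [integral_finsetSum _ fun σ _ => integrable_lossSup hg hmeas _ _, ← Finset.mul_sum]
  ring

/-! ### Uniform deviation of empirical means -/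

/-- With probability at least `1 - 2 exp (-u)`, every expectation is bounded by the empirical mean,
twice the empirical Rademacher average, and a deviation term. Of the factor `3`, one is spent on
the concentration of the maximal deviation and two on that of the Rademacher average. -/
theorem measureReal_deviation_le (hgm : ∀ i, Measurable (g i)) (hg : ∀ i z, |g i z| ≤ B)
    {c u : ℝ} (hc : 0 < c) (hu : 0 ≤ u) (hosc : ∀ i z z', |g i z - g i z'| ≤ c)
    {n : ℕ} (hn : 0 < n) (hmeas : ∀ (b : ℝ) (a : Fin n → ℝ),
      AEMeasurable (fun S => lossSup P g b a S) (Measure.pi fun _ => P)) :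
    (Measure.pi fun _ => P).real {S : Fin n → Z | ∃ i,
        (1 / (n : ℝ)) * ∑ j, g i (S j) + 2 * rademacherAvg (fun i j => g i (S j))
          + 3 * (c * Real.sqrt (u / (2 * n))) < ∫ z, g i z ∂P}
      ≤ 2 * Real.exp (-u) := by
  have hn' : (0 : ℝ) < n := by exact_mod_cast hn
  set ε := c * Real.sqrt (u / (2 * n)) with hε
  set Φ : (Fin n → Z) → ℝ := lossSup P g 1 (fun _ : Fin n => -(1 / (n : ℝ))) with hΦ
  set R : (Fin n → Z) → ℝ := fun S => rademacherAvg (fun i j => g i (S j)) with hR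
  have hΦc : ∀ S j z, |Φ (Function.update S j z) - Φ S| ≤ c / n := fun S j z => by
    refine (abs_lossSup_update_sub_le hg hosc _ _ S j z).trans_eq ?_
    rw [abs_neg, abs_of_pos (by positivity)]
    ring
  have hRc : ∀ S j z, |R (Function.update S j z) - R S| ≤ c / n := fun S j z => by
    simp only [hR, rademacherAvg_eq_sum_lossSup P g]
    rw [← mul_sub, ← Finset.sum_sub_distrib, abs_mul, abs_of_pos (by positivity)]
    have hsum : |∑ σ : Fin n → ℤˣ,
        (lossSup P g 0 (fun j => ((σ j : ℤ) : ℝ) * (1 / (n : ℝ))) (Function.update S j z)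
          - lossSup P g 0 (fun j => ((σ j : ℤ) : ℝ) * (1 / (n : ℝ))) S)|
        ≤ ∑ _ : Fin n → ℤˣ, c / n := by
      refine (Finset.abs_sum_le_sum_abs _ _).trans (Finset.sum_le_sum fun σ _ => ?_)
      refine (abs_lossSup_update_sub_le hg hosc _ _ S j z).trans_eq ?_
      rw [abs_mul, abs_sign, abs_of_pos (by positivity)]
      ring
    refine (mul_le_mul_of_nonneg_left hsum (by positivity)).trans_eq ?_
    simp [Fintype.card_pi]
  have hRi : Integrable R (Measure.pi fun _ => P) := integrable_rademacherAvg hg hmeas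
  have hRK : ∀ S, |R S| ≤ B := fun S => by
    obtain ⟨i⟩ := ‹Nonempty ι›
    have hsum : |∑ σ : Fin n → ℤˣ, ⨆ i, (1 / (n : ℝ)) * ∑ j, ((σ j : ℤ) : ℝ) * g i (S j)|
        ≤ ∑ _ : Fin n → ℤˣ, B := by
      refine (Finset.abs_sum_le_sum_abs _ _).trans (Finset.sum_le_sum fun σ _ => ?_)
      refine abs_ciSup_le fun i => (abs_sum_signs_le σ fun j => hg i (S j)).trans_eq ?_
      field_simp
    simp only [hR, rademacherAvg]
    rw [abs_mul, abs_of_pos (by positivity)]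
    refine (mul_le_mul_of_nonneg_left hsum (by positivity)).trans_eq ?_
    simp [Fintype.card_pi]
  have h1 := measureReal_bounded_differences_le P hc hu hn Φ (hmeas _ _)
    (abs_lossSup_le hg _ _) hΦc
  have h2 := measureReal_bounded_differences_le P hc hu hn (fun S => -R S) hRi.aemeasurable.neg
    (K := B) (fun S => by rw [abs_neg]; exact hRK S) (fun S j z => by
      rw [neg_sub_neg, abs_sub_comm]
      exact hRc S j z)
  rw [integral_neg] at h2
  have hsymm := integral_deviation_le hgm hg hn hmeas
  rw [two_mul]
  refine (measureReal_mono ?_).trans ((measureReal_union_le _ _).trans (add_le_add h1 h2))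
  rintro S ⟨i, hi⟩
  by_contra hS
  simp only [Set.mem_union, Set.mem_ofPred_eq, not_or, not_le] at hS
  have hdev : ∫ z, g i z ∂P - (1 / (n : ℝ)) * ∑ j, g i (S j) ≤ Φ S := by
    refine le_trans (le_of_eq ?_) (le_ciSup (bddAbove_combination hg _ _ _) i)
    rw [← Finset.mul_sum]
    ring
  linarith [hS.1, hS.2]

end

/-! ### Scalarization -/

theorem le_scalarize {N : ℕ} {W : Set (Fin N → ℝ)} (hWsimplex : W ⊆ stdSimplex ℝ (Fin N))
    (v : Fin N → ℝ) {w : Fin N → ℝ} (hw : w ∈ W) : ∑ i, w i * v i ≤ scalarize W v := by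
  have hb : BddAbove (Set.range fun w : W => ∑ i, (w : Fin N → ℝ) i * v i) := by
    refine ⟨∑ i, |v i|, ?_⟩
    rintro _ ⟨⟨w, hw⟩, rfl⟩
    obtain ⟨h0, h1⟩ := hWsimplex hw
    refine Finset.sum_le_sum fun i _ => ?_
    have hle : w i ≤ 1 := h1 ▸ Finset.single_le_sum (fun k _ => h0 k) (Finset.mem_univ i)
    calc w i * v i ≤ w i * |v i| := mul_le_mul_of_nonneg_left (le_abs_self _) (h0 i)
      _ ≤ 1 * |v i| := mul_le_mul_of_nonneg_right hle (abs_nonneg _)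
      _ = |v i| := one_mul _
  exact le_ciSup hb ⟨w, hw⟩

/-- Bounds that hold for each objective pass to the scalarizations: an error term that is linear
in the constants `M i` is multiplied by at most `β`. -/
theorem scalarize_le_scalarize_add {N : ℕ} {W : Set (Fin N → ℝ)} (hW : W.Nonempty)
    (hWsimplex : W ⊆ stdSimplex ℝ (Fin N)) {M v v' : Fin N → ℝ} {β r : ℝ} (hr : 0 ≤ r)
    (hβ : ∀ w ∈ W, ∑ i, w i * M i ≤ β) (h : ∀ i, v i ≤ v' i + M i * r) :
    scalarize W v ≤ scalarize W v' + β * r := by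
  have : Nonempty W := hW.to_subtype
  refine ciSup_le fun ⟨w, hw⟩ => ?_
  calc ∑ i, w i * v i ≤ ∑ i, w i * (v' i + M i * r) :=
        Finset.sum_le_sum fun i _ => mul_le_mul_of_nonneg_left (h i) ((hWsimplex hw).1 i)
    _ = ∑ i, w i * v' i + (∑ i, w i * M i) * r := by
        rw [Finset.sum_mul, ← Finset.sum_add_distrib]
        exact Finset.sum_congr rfl fun i _ => by ring
    _ ≤ scalarize W v' + β * r :=
        add_le_add (le_scalarize hWsimplex v' hw) (mul_le_mul_of_nonneg_right (hβ w hw) hr)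

/-! ### Seminorms on pairs -/

theorem seminorm_fst_eq (nrm : Seminorm ℝ (ℝ × ℝ)) (r : ℝ) : nrm (r, 0) = |r| * nrm (1, 0) := by
  have h := map_smul_eq_mul nrm r (1, 0)
  simpa using h

theorem seminorm_snd_eq (nrm : Seminorm ℝ (ℝ × ℝ)) (r : ℝ) : nrm (0, r) = |r| * nrm (0, 1) := by
  have h := map_smul_eq_mul nrm r (0, 1)
  simpa using h

/-- All seminorms on the plane are dominated by the standard norm, so a function that is Lipschitz
for one of them is continuous. -/
theorem continuous_of_lipschitz_seminorm {Y : Set ℝ} (nrm : Seminorm ℝ (ℝ × ℝ)) {ℓ : Y → Y → ℝ}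
    {M : ℝ} (hM : 0 ≤ M)
    (hlip : ∀ y a y' a' : Y,
      |ℓ y a - ℓ y' a'| ≤ M * nrm ((a : ℝ) - (a' : ℝ), (y : ℝ) - (y' : ℝ))) :
    Continuous fun p : Y × Y => ℓ p.1 p.2 := by
  refine (LipschitzWith.of_dist_le' (K := M * (nrm (1, 0) + nrm (0, 1))) fun p q => ?_).continuous
  rw [Real.dist_eq, mul_assoc]
  refine (hlip _ _ _ _).trans (mul_le_mul_of_nonneg_left ?_ hM)
  have h1 : |(p.2 : ℝ) - q.2| ≤ dist p q := by
    rw [← Real.dist_eq]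
    exact le_max_right (dist p.1 q.1) (dist p.2 q.2)
  have h2 : |(p.1 : ℝ) - q.1| ≤ dist p q := by
    rw [← Real.dist_eq]
    exact le_max_left (dist p.1 q.1) (dist p.2 q.2)
  have hadd : nrm ((p.2 : ℝ) - q.2, (p.1 : ℝ) - q.1)
      ≤ nrm ((p.2 : ℝ) - q.2, 0) + nrm (0, (p.1 : ℝ) - q.1) := by
    simpa using map_add_le_add nrm ((p.2 : ℝ) - q.2, 0) (0, (p.1 : ℝ) - q.1)
  rw [seminorm_fst_eq, seminorm_snd_eq] at hadd
  have := mul_le_mul_of_nonneg_right h1 (apply_nonneg nrm (1, 0))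
  have := mul_le_mul_of_nonneg_right h2 (apply_nonneg nrm (0, 1))
  linarith

/-- A set of reals that has finite diameter for the norm `nrm (0, ·)` is bounded. -/
theorem exists_abs_le_of_seminorm_diam {Y : Set ℝ} (nrm : Seminorm ℝ (ℝ × ℝ))
    (hnrm : ∀ v, nrm v = 0 → v = 0) {D : ℝ} (h : ∀ y y' : Y, nrm (0, (y' : ℝ) - (y : ℝ)) ≤ D) :
    ∃ K, ∀ y : Y, |(y : ℝ)| ≤ K := by
  rcases isEmpty_or_nonempty Y with hY | ⟨⟨y₀⟩⟩
  · exact ⟨0, fun y => hY.elim y⟩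
  have hpos : 0 < nrm (0, 1) :=
    (apply_nonneg nrm _).lt_of_ne fun h0 => by simpa using hnrm _ h0.symm
  refine ⟨D / nrm (0, 1) + |(y₀ : ℝ)|, fun y => ?_⟩
  have h1 := h y₀ y
  rw [seminorm_snd_eq, ← le_div_iff₀ hpos] at h1
  calc |(y : ℝ)| = |((y : ℝ) - y₀) + y₀| := by rw [sub_add_cancel]
    _ ≤ |(y : ℝ) - y₀| + |(y₀ : ℝ)| := abs_add_le _ _
    _ ≤ _ := by gcongr

/-! ### The generalization bound -/

/-- The bound for a single `M`-Lipschitz loss, with the Rademacher complexity of the hypothesis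
set in place of that of the loss class. -/
theorem measureReal_risk_gt_le {X : Type*} [MeasurableSpace X] {Y : Set ℝ}
    (P : Measure (X × Y)) [IsProbabilityMeasure P]
    {H : Set (X → Y)} [Nonempty H] (hHmeas : ∀ h ∈ H, Measurable h)
    (nrm : Seminorm ℝ (ℝ × ℝ)) (hnrm_one : nrm (1, 0) ≤ 1) {D : ℝ} (hD : 0 < D)
    (hdiam : ∀ h ∈ H, ∀ (x x' : X) (y y' : Y),
      nrm ((h x' : ℝ) - (h x : ℝ), (y' : ℝ) - (y : ℝ)) ≤ D)
    {K : ℝ} (hK : ∀ y : Y, |(y : ℝ)| ≤ K)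
    {ℓ : Y → Y → ℝ} {B : ℝ} (hB : ∀ y a, |ℓ y a| ≤ B) {M : ℝ} (hM : 0 ≤ M)
    (hlip : ∀ y a y' a' : Y,
      |ℓ y a - ℓ y' a'| ≤ M * nrm ((a : ℝ) - (a' : ℝ), (y : ℝ) - (y' : ℝ)))
    (hsup : MeasurableSuprema P ℓ H) {n : ℕ} (hn : 0 < n) {u : ℝ} (hu : 0 ≤ u) :
    (Measure.pi fun _ => P).real {S : Fin n → X × Y | ∃ h ∈ H,
        empRisk S ℓ h + M * (2 * empRademacher S H + 3 * D * Real.sqrt (u / (2 * n)))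
          < risk P ℓ h}
      ≤ 2 * Real.exp (-u) := by
  let g : H → X × Y → ℝ := fun h z => ℓ z.2 ((h : X → Y) z.1)
  have hosc : ∀ h z z', |g h z - g h z'| ≤ M * D := fun h z z' =>
    (hlip _ _ _ _).trans (mul_le_mul_of_nonneg_left (hdiam h h.2 _ _ _ _) hM)
  rcases hM.eq_or_lt with rfl | hMpos
  · -- a `0`-Lipschitz loss is constant, so the empirical risk is the risk
    convert (by positivity : (0 : ℝ) ≤ 2 * Real.exp (-u)) using 1
    convert measureReal_empty
    rw [Set.eq_empty_iff_forall_notMem]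
    rintro S ⟨h, hh, hlt⟩
    have hconst : ∀ z : X × Y, ℓ z.2 (h z.1) = ℓ (S ⟨0, hn⟩).2 (h (S ⟨0, hn⟩).1) := fun z => by
      have := hosc ⟨h, hh⟩ z (S ⟨0, hn⟩)
      rw [zero_mul] at this
      exact sub_eq_zero.1 (abs_nonpos_iff.1 this)
    have hn' : (n : ℝ) ≠ 0 := by positivity
    have heq : empRisk S ℓ h = risk P ℓ h := by
      rw [empRisk, risk, integral_congr_ae (Filter.Eventually.of_forall hconst),
        Finset.sum_congr rfl fun j _ => hconst (S j)]
      simp [hn']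
    rw [heq] at hlt
    simp at hlt
  have hcont := continuous_of_lipschitz_seminorm nrm hM hlip
  have hgm : ∀ h, Measurable (g h) := fun h =>
    hcont.measurable.comp (measurable_snd.prodMk ((hHmeas h h.2).comp measurable_fst))
  refine (measureReal_mono ?_).trans (measureReal_deviation_le (P := P) hgm (fun h z => hB _ _)
    (mul_pos hMpos hD) hu hosc hn fun b a => hsup n a b)
  rintro S ⟨h, hh, hlt⟩
  refine ⟨⟨h, hh⟩, ?_⟩
  have hB' : ∀ y a, |ℓ y a| ≤ max K B := fun y a => (hB y a).trans (le_max_right _ _)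
  have hcontr : rademacherAvg (fun (h : H) j => g h (S j)) ≤ M * empRademacher S H := by
    refine rademacherAvg_contraction (K := max K B)
      (u := fun (h : H) (j : Fin n) => (((h : X → Y) (S j).1 : Y) : ℝ)) hM
      (fun h j => (hK _).trans (le_max_left _ _)) (fun h j => hB' _ _) fun h h' j => ?_
    refine (hlip _ _ _ _).trans (mul_le_mul_of_nonneg_left ?_ hM)
    rw [sub_self, seminorm_fst_eq]
    exact mul_le_of_le_one_right (abs_nonneg _) hnrm_one
  change empRisk S ℓ h + 2 * _ + _ < risk P ℓ h
  linarith

theorem theorem6 {X : Type*} [MeasurableSpace X] (Y : Set ℝ)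
    (P : Measure (X × Y)) [IsProbabilityMeasure P]
    (H : Set (X → Y)) (hHmeas : ∀ h ∈ H, Measurable h)
    -- the norm on pairs (prediction, label)
    (nrm : Seminorm ℝ (ℝ × ℝ)) (hnrm_def : ∀ v, nrm v = 0 → v = 0) (hnrm_one : nrm (1, 0) ≤ 1)
    (D : ℝ) (hD : 0 < D)
    (hdiam : ∀ h ∈ H, ∀ (x x' : X) (y y' : Y),
      nrm ((h x' : ℝ) - (h x : ℝ), (y' : ℝ) - (y : ℝ)) ≤ D)
    (N : ℕ) (ℓ : Fin N → Y → Y → ℝ) (hℓ_nonneg : ∀ i y a, 0 ≤ ℓ i y a)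
    (B : ℝ) (hℓ_le : ∀ i y a, ℓ i y a ≤ B)
    (M : Fin N → ℝ) (hM : ∀ i, 0 ≤ M i)
    (hℓ_lip : ∀ i (y a y' a' : Y),
      |ℓ i y a - ℓ i y' a'| ≤ M i * nrm ((a : ℝ) - (a' : ℝ), (y : ℝ) - (y' : ℝ)))
    (hsup : ∀ i, MeasurableSuprema P (ℓ i) H)
    (W : Set (Fin N → ℝ)) (hW : W.Nonempty) (hWsimplex : W ⊆ stdSimplex ℝ (Fin N))
    (β : ℝ) (hβ : ∀ w ∈ W, ∑ i, w i * M i ≤ β)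
    (n : ℕ) (hn : 0 < n) (δ : ℝ) (hδ0 : 0 < δ) (hδ1 : δ < 1) :
    -- with probability at least `1 - δ` over an i.i.d. sample `S` of size `n`
    ∃ E : Set (Fin n → X × Y), MeasurableSet E ∧
      ENNReal.ofReal (1 - δ) ≤ (Measure.pi fun _ => P) E ∧
      ∀ S ∈ E, ∀ h ∈ H,
        scalarize W (fun i => risk P (ℓ i) h) ≤
          scalarize W (fun i => empRisk S (ℓ i) h)
            + 2 * β * empRademacher S H
            + 3 * β * D * Real.sqrt (Real.log (2 * (N : ℝ) / δ) / (2 * (n : ℝ))) := by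
  rcases H.eq_empty_or_nonempty with rfl | hH
  · refine ⟨Set.univ, MeasurableSet.univ, ?_, fun S _ h hh => absurd hh (Set.notMem_empty h)⟩
    rw [measure_univ, ENNReal.ofReal_le_one]
    linarith
  have : Nonempty H := hH.to_subtype
  have hN : 1 ≤ (N : ℝ) := by
    obtain ⟨w, hw⟩ := hW
    have h1 := (hWsimplex hw).2
    rcases Nat.eq_zero_or_pos N with rfl | hpos
    · simp at h1
    · exact_mod_cast hpos
  obtain ⟨K, hK⟩ : ∃ K, ∀ y : Y, |(y : ℝ)| ≤ K := by
    obtain ⟨h, hh⟩ := hH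
    obtain ⟨⟨x, -⟩⟩ : Nonempty (X × Y) := nonempty_of_isProbabilityMeasure P
    exact exists_abs_le_of_seminorm_diam nrm hnrm_def fun y y' => by
      simpa using hdiam h hh x x y y'
  set u := Real.log (2 * (N : ℝ) / δ) with hu_def
  have hu : 0 ≤ u := Real.log_nonneg (by rw [le_div_iff₀ hδ0]; linarith)
  have hexp : 2 * Real.exp (-u) = δ / N := by
    rw [hu_def, Real.exp_neg, Real.exp_log (by positivity)]
    field_simp
  let bad : Fin N → Set (Fin n → X × Y) := fun i => {S | ∃ h ∈ H,
    empRisk S (ℓ i) h + M i * (2 * empRademacher S H + 3 * D * Real.sqrt (u / (2 * n)))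
      < risk P (ℓ i) h}
  have hbad : ∀ i, (Measure.pi fun _ => P).real (bad i) ≤ δ / N := fun i =>
    (measureReal_risk_gt_le P hHmeas nrm hnrm_one hD hdiam hK
      (fun y a => by rw [abs_of_nonneg (hℓ_nonneg i y a)]; exact hℓ_le i y a) (hM i)
      (hℓ_lip i) (hsup i) hn hu).trans_eq hexp
  have hunion : (Measure.pi fun _ => P).real (⋃ i, bad i) ≤ δ := by
    refine (measureReal_iUnion_fintype_le bad).trans
      ((Finset.sum_le_sum fun i _ => hbad i).trans_eq ?_)
    rw [Finset.sum_const, Finset.card_univ, Fintype.card_fin, nsmul_eq_mul]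
    field_simp
  -- the bad events need not be measurable
  refine ⟨(toMeasurable (Measure.pi fun _ => P) (⋃ i, bad i))ᶜ,
    (measurableSet_toMeasurable _ _).compl, ?_, fun S hS h hh => ?_⟩
  · rw [prob_compl_eq_one_sub (measurableSet_toMeasurable _ _), measure_toMeasurable,
      ENNReal.ofReal_sub _ hδ0.le, ENNReal.ofReal_one]
    refine tsub_le_tsub_left ?_ _
    rw [← ENNReal.ofReal_toReal (measure_ne_top _ (⋃ i, bad i))]
    exact ENNReal.ofReal_le_ofReal hunion
  · have hgood : ∀ i, risk P (ℓ i) h ≤ empRisk S (ℓ i) h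
        + M i * (2 * empRademacher S H + 3 * D * Real.sqrt (u / (2 * n))) := fun i => by
      by_contra hlt
      exact hS (subset_toMeasurable _ _ (Set.mem_iUnion.2 ⟨i, h, hh, not_le.1 hlt⟩))
    have hrad : 0 ≤ empRademacher S H :=
      rademacherAvg_nonneg (u := fun (h : H) (j : Fin n) => (((h : X → Y) (S j).1 : Y) : ℝ))
        fun h j => hK _
    refine (scalarize_le_scalarize_add hW hWsimplex (by positivity) hβ hgood).trans_eq ?_
    ring
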